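/- **Model.** Let $N\ge 3$ and $p_0,p_1,p_2,p_3\in[0,1]$, and put $q_m:=1-p_m$. Let $\Sigma:=\{0,1\}^N$; for $x\in\Sigma$ and $i\in\{1,\dots,N\}$ (player indices modulo $N$) let $m_i(x):=2x_{i-1}+x_{i+1}$ and let $x^i$ be $x$ with its $i$th component flipped. Let $P$ be the transition matrix on $\Sigma$ with $$P(x,x^i)=\begin{cases}N^{-1}p_{m_i(x)},&x_i=0,\\ N^{-1}q_{m_i(x)},&x_i=1,\end{cases}\qquad P(x,x)=N^{-1}\Big(\sum_{i:x_i=0}q_{m_i(x)}+\sum_{i:x_i=1}p_{m_i(x)}\Big),$$ and $P(x,y)=0$ otherwise. Let $P^*$ be the transition matrix on $\Sigma^*:=\Sigma\times\{1,\dots,N\}$ with, for all $j$, $$P^*((x,i),(x^i,j))=\begin{cases}N^{-1}p_{m_i(x)},&x_i=0,\\ N^{-1}q_{m_i(x)},&x_i=1,\end{cases}\qquad P^*((x,i),(x,j))=\begin{cases}N^{-1}q_{m_i(x)},&x_i=0,\\ N^{-1}p_{m_i(x)},&x_i=1,\end{cases}$$ and $0$ otherwise. The payoff $w((x,i),(y,j))$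 of a transition is $+1$ if player $i$ wins ($y=x^i$ and $x_i=0$, or $y=x$ and $x_i=1$), and $-1$ if player $i$ loses ($y=x^i$ and $x_i=1$, or $y=x$ and $x_i=0$). The continuous-time Markov chain in $\Sigma^*$ with infinitesimal matrix $Q^*:=P^*-I$ is represented as $Y^*(t)=X^*(N(t))$, where $(X^*(n))_{n\ge0}$ is a discrete-time Markov chain with transition matrix $P^*$ and arbitrary initial distribution, and $(N(t))_{t\ge0}$ is an independent Poisson process of rate $1$. Let $S_n:=\sum_{k=1}^n w(X^*(k-1),X^*(k))$. The cumulative profit to the ensemble of $N$ players at time $t$ is $\hat S_t:=S_{N(t)}$ (so jumps from a state to itself are counted). **Theorem.** Assume that the parameters satisfy the ergodicity conditions, i.e. none of the following holds: $(p_0,p_3)=(0,1)$; $N$ is even and $(p_0,p_3)=(1,0)$; $(p_0,p_1,p_2,p_3)$ is $(1,0,0,0)$ or $(1,1,1,0)$; $3\mid N$ and either $(p_0,p_1,p_2)=(1,0,0)$ or $(p_1,p_2,p_3)=(1,1,0)$; $N=3$ and either $(p_0,p_1,p_2)=(0,1,1)$ or $(p_1,p_2,p_3)=(0,0,1)$.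 Then $P$ has a unique stationary distribution $\pi$, and, with $$\mu^N:=\frac1N\sum_{x\in\Sigma}\pi(x)\sum_{i=1}^N\big[p_{m_i(x)}-q_{m_i(x)}\big],$$ $$\lim_{t\to\infty}t^{-1}\hat S_t=\mu^N\quad\text{almost surely}.$$ Here $\mu^N$ is the mean profit per turn of the discrete-time model, i.e. $n^{-1}S_n\to\mu^N$ almost surely; moreover the two-dimensional marginals $\pi_{i,i+2}$ of $\pi$ do not depend on $i$, and for every $i$ $$\mu^N=\sum_{u=0}^1\sum_{v=0}^1\pi_{i,i+2}(u,v)\,(p_{2u+v}-q_{2u+v})=\pi_i(1)-\pi_i(0).$$ -/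

import Mathlib

open MeasureTheory ProbabilityTheory Filter Topology
open scoped NNReal

namespace Parrondo

/-- Status of the `N` players on a circle (cyclic index set `Fin N`): `0` loser, `1` winner. -/
abbrev Config (N : ℕ) := Fin N → Fin 2

/-- Status of the players together with the next player to play. -/
abbrev State (N : ℕ) := Config N × Fin N

/-- The integer `2u + v` with binary representation `(u v)`. -/
def pairIndex (u v : Fin 2) : Fin 4 := ⟨2 * u.val + v.val, by omega⟩

section

variable {N : ℕ} [NeZero N]

/-- `m_i(x) = 2 x_{i-1} + x_{i+1}`, indices modulo `N`. -/
def nbrIndex (x : Config N) (i : Fin N) : Fin 4 := pairIndex (x (i - 1)) (x (i + 1))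

/-- The configuration equal to `x` except at the component `i`. -/
def flipAt (x : Config N) (i : Fin N) : Config N := Function.update x i (1 - x i)

noncomputable section

/-- Probability that the status of player `i` changes when this player plays in configuration `x`:
a loser wins, or a winner loses. -/
def changeProb (p : Fin 4 → ℝ) (x : Config N) (i : Fin N) : ℝ :=
  if x i = 0 then p (nbrIndex x i) else 1 - p (nbrIndex x i)

/-- Probability that the status of player `i` stays the same when this player plays in
configuration `x`: a loser loses, or a winner wins. -/
def stayProb (p : Fin 4 → ℝ) (x : Config N) (i : Fin N) : ℝ :=
  if x i = 0 then 1 - p (nbrIndex x i) else p (nbrIndex x i)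

/-- One-step transition matrix of the status chain on `Config N`. For `y ≠ x` at most one term of
the second sum is nonzero. -/
def transP (p : Fin 4 → ℝ) : Matrix (Config N) (Config N) ℝ := fun x y =>
  if y = x then (N : ℝ)⁻¹ * ∑ i, stayProb p x i
  else ∑ i, if y = flipAt x i then (N : ℝ)⁻¹ * changeProb p x i else 0

/-- One-step transition matrix of the chain on `State N`: player `i` plays, and then the next player
`j` is chosen uniformly. -/
def transPstar (p : Fin 4 → ℝ) : Matrix (State N) (State N) ℝ := fun a b =>
  if b.1 = flipAt a.1 a.2 then (N : ℝ)⁻¹ * changeProb p a.1 a.2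
  else if b.1 = a.1 then (N : ℝ)⁻¹ * stayProb p a.1 a.2
  else 0

/-- Payoff of a transition: `1` if the player who plays wins, `-1` if this player loses (and `0` for
the pairs of states that are never successive). -/
def payoff (a b : State N) : ℝ :=
  if b.1 = flipAt a.1 a.2 then (if a.1 a.2 = 0 then 1 else -1)
  else if b.1 = a.1 then (if a.1 a.2 = 0 then -1 else 1)
  else 0

/-- Mean profit per turn to the ensemble when the configuration has law `ρ`. -/
def meanProfit (p : Fin 4 → ℝ) (ρ : Config N → ℝ) : ℝ :=
  (N : ℝ)⁻¹ * ∑ x, ρ x * ∑ i, (p (nbrIndex x i) - (1 - p (nbrIndex x i)))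

/-- One-dimensional marginal of `ρ`. -/
def marginal (ρ : Config N → ℝ) (i : Fin N) (u : Fin 2) : ℝ :=
  ∑ x, if x i = u then ρ x else 0

/-- Two-dimensional marginal of `ρ`. -/
def marginalPair (ρ : Config N → ℝ) (i j : Fin N) (u v : Fin 2) : ℝ :=
  ∑ x, if x i = u ∧ x j = v then ρ x else 0

end

end

/-- The parameter vectors for which the status chain is ergodic. -/
def ErgodicityConditions (N : ℕ) (p : Fin 4 → ℝ) : Prop :=
  ¬ (p 0 = 0 ∧ p 3 = 1) ∧
  ¬ (Even N ∧ p 0 = 1 ∧ p 3 = 0) ∧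
  ¬ (p 0 = 1 ∧ p 1 = 0 ∧ p 2 = 0 ∧ p 3 = 0) ∧
  ¬ (p 0 = 1 ∧ p 1 = 1 ∧ p 2 = 1 ∧ p 3 = 0) ∧
  ¬ (3 ∣ N ∧ ((p 0 = 1 ∧ p 1 = 0 ∧ p 2 = 0) ∨ (p 1 = 1 ∧ p 2 = 1 ∧ p 3 = 0))) ∧
  ¬ (N = 3 ∧ ((p 0 = 0 ∧ p 1 = 1 ∧ p 2 = 1) ∨ (p 1 = 0 ∧ p 2 = 0 ∧ p 3 = 1)))

/-- `ρ` is a probability vector with `ρ P = ρ`. -/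
def IsStationary {S : Type*} [Fintype S] (P : Matrix S S ℝ) (ρ : S → ℝ) : Prop :=
  ρ ∈ stdSimplex ℝ S ∧ Matrix.vecMul ρ P = ρ

/-- `X` is a discrete-time Markov chain with one-step transition matrix `P` (and an arbitrary
initial distribution). -/
structure IsMarkovChain {Ω S : Type*} [MeasurableSpace Ω] [MeasurableSpace S]
    (P : Matrix S S ℝ) (X : ℕ → Ω → S) (Pr : Measure Ω) : Prop where
  measurable : ∀ n, Measurable (X n)
  markov : ∀ (n : ℕ) (a : ℕ → S),
    Pr.real {ω | ∀ k ≤ n + 1, X k ω = a k} =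
      Pr.real {ω | ∀ k ≤ n, X k ω = a k} * P (a n) (a (n + 1))

/-- `T` is a Poisson process of rate `r`. Since the paths are nondecreasing, the truncated
subtraction in the increments is the actual one, almost surely. -/
structure IsPoissonProcess {Ω : Type*} [MeasurableSpace Ω]
    (r : ℝ≥0) (T : ℝ≥0 → Ω → ℕ) (Pr : Measure Ω) : Prop where
  measurable : ∀ t, Measurable (T t)
  zero : ∀ᵐ ω ∂Pr, T 0 ω = 0
  monotone : ∀ᵐ ω ∂Pr, Monotone fun t => T t ω
  rightCts : ∀ᵐ ω ∂Pr, ∀ t, ContinuousWithinAt (fun s => T s ω) (Set.Ici t) t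
  law : ∀ s t, s ≤ t → Pr.map (fun ω => T t ω - T s ω) = poissonMeasure (r * (t - s))
  indep : HasIndepIncrements T Pr

/-- The continuous-time model with infinitesimal matrix `P* - I`, in the representation in which
jumps from a state to itself are recognizable: the continuous-time chain is `t ↦ X (T t)`, where `X`
is a discrete-time chain with transition matrix `P*` and `T` an independent rate 1 Poisson process
that counts all jumps. -/
structure IsContinuousTimeModel {Ω : Type*} [MeasurableSpace Ω] {N : ℕ} [NeZero N]
    (p : Fin 4 → ℝ) (X : ℕ → Ω → State N) (T : ℝ≥0 → Ω → ℕ) (Pr : Measure Ω) : Prop where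
  chain : IsMarkovChain (transPstar p) X Pr
  poisson : IsPoissonProcess 1 T Pr
  indep : IndepFun (fun ω n => X n ω) (fun ω t => T t ω) Pr

/-- Cumulative profit `S_n` to the ensemble after `n` steps of the discrete-time chain. -/
noncomputable def cumProfit {Ω : Type*} {N : ℕ} [NeZero N] (X : ℕ → Ω → State N)
    (n : ℕ) (ω : Ω) : ℝ :=
  ∑ k ∈ Finset.range n, payoff (X k ω) (X (k + 1) ω)

/-- Cumulative profit to the ensemble at time `t` in the continuous-time model: the sum of the
payoffs of all the jumps (including those from a state to itself) up to time `t`. -/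
noncomputable def cumProfitCts {Ω : Type*} {N : ℕ} [NeZero N] (X : ℕ → Ω → State N)
    (T : ℝ≥0 → Ω → ℕ) (t : ℝ≥0) (ω : Ω) : ℝ :=
  cumProfit X (T t ω) ω

end Parrondo

/-!
Under the ergodicity conditions some configuration can be reached from every configuration.
Indeed, minimizing the number of players of a given status along sequences of possible moves leads
to a constant configuration, except when `(p 0, p 3) = (1, 0)`; then `N` is odd, and a sweep once
around the circle that makes neighbours disagree leads to an alternating configuration.

By the maximum principle, the functions that are harmonic for the status chain are then constant.
Hence the stationary law `π` is unique, and therefore invariant under rotations, and the Poisson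
equation `g - P g = h - π(h)` can be solved, where `h` is the mean payoff of a turn. Its solution,
lifted to `P*`, turns `S_n - n μ` into a bounded boundary term plus a sum of bounded, pairwise
orthogonal martingale differences. This sum is almost surely `o(n)`, by Chebyshev's inequality along
the squares. As `T t / t → 1` almost surely, the continuous-time limit is a time change of this one.
-/

namespace Parrondo

lemma exists_nsmul_eq_of_addOrderOf_eq_card {G : Type*} [AddGroup G] [Finite G] {d : G}
    (hd : addOrderOf d = Nat.card G) (j : G) : ∃ k < Nat.card G, k • d = j := by
  classical
  have htop : AddSubgroup.zmultiples d = ⊤ :=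
    AddSubgroup.eq_top_of_card_eq _ (by rw [Nat.card_zmultiples, hd])
  have hj : j ∈ AddSubgroup.zmultiples d := htop ▸ AddSubgroup.mem_top j
  simpa [hd] using mem_zmultiples_iff_mem_range_addOrderOf.1 hj

lemma exists_reflTransGen_minimal {S : Type*} (r : S → S → Prop) (f : S → ℕ) (x : S) :
    ∃ y, Relation.ReflTransGen r x y ∧ ∀ z, Relation.ReflTransGen r y z → f y ≤ f z := by
  obtain ⟨y, hy, hmin⟩ := WellFounded.has_min (measure f).wf
    {y | Relation.ReflTransGen r x y} ⟨x, .refl⟩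
  exact ⟨y, hy, fun z hz => not_lt.1 (hmin z (hy.trans hz))⟩

lemma eq_or_eq_of_ne {s t : Fin 2} (h : s ≠ t) (a : Fin 2) : a = s ∨ a = t := by
  revert s t a; decide

lemma one_sub_eq_iff {a b : Fin 2} : 1 - a = b ↔ a ≠ b := by
  revert a b; decide

section Flip

variable {N : ℕ}

@[simp] lemma flipAt_self (x : Config N) (i : Fin N) : flipAt x i i = 1 - x i := by
  simp [flipAt]

lemma flipAt_of_ne (x : Config N) {i j : Fin N} (h : j ≠ i) : flipAt x i j = x j := by
  simp [flipAt, h]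

lemma flipAt_ne (x : Config N) (i : Fin N) : flipAt x i ≠ x := fun h =>
  one_sub_eq_iff.1 (by simpa using congrFun h i) rfl

lemma flipAt_flipAt (x : Config N) (i : Fin N) : flipAt (flipAt x i) i = x := by
  simp [flipAt]

/-- The number of players with status `t`. -/
def countStatus (t : Fin 2) (x : Config N) : ℕ := (Finset.univ.filter fun i => x i = t).card

variable {t : Fin 2} {x : Config N} {i : Fin N}

lemma countStatus_flipAt_of_eq (h : x i = t) :
    countStatus t (flipAt x i) + 1 = countStatus t x := by
  have herase : (Finset.univ.filter fun j => flipAt x i j = t) =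
      (Finset.univ.filter fun j => x j = t).erase i := by
    ext j
    rcases eq_or_ne j i with rfl | hj
    · simp [h, one_sub_eq_iff]
    · simp [flipAt_of_ne x hj, hj]
  rw [countStatus, herase, Finset.card_erase_add_one (by simpa using h), countStatus]

lemma countStatus_flipAt_of_ne (h : x i ≠ t) :
    countStatus t (flipAt x i) = countStatus t x + 1 := by
  rw [← countStatus_flipAt_of_eq (x := flipAt x i) (i := i) (by simpa [one_sub_eq_iff] using h),
    flipAt_flipAt]

end Flip

section Reachability

variable {N : ℕ} [NeZero N]

lemma addOrderOf_fin_one : addOrderOf (1 : Fin N) = N := by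
  obtain ⟨n, rfl⟩ := Nat.exists_eq_succ_of_ne_zero (NeZero.ne N)
  exact ZMod.addOrderOf_one (n + 1)

lemma fin_nsmul_one_ne_zero {k : ℕ} (hk : k ≠ 0) (hkN : k < N) : k • (1 : Fin N) ≠ 0 :=
  nsmul_ne_zero_of_lt_addOrderOf hk (by rwa [addOrderOf_fin_one])

/-- A rule says which players may change status: `A l c r` when a player of status `c` whose left
and right neighbours have statuses `l` and `r` may do so. -/
abbrev FlipRule := Fin 2 → Fin 2 → Fin 2 → Prop

/-- The moves on configurations in which one player changes status as allowed by the rule `A`. -/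
def FlipStep (A : FlipRule) (x y : Config N) : Prop :=
  ∃ i, A (x (i - 1)) (x i) (x (i + 1)) ∧ y = flipAt x i

/-- No sequence of moves allowed by `A` decreases the number of players with status `t`. -/
def IsCountMinimal (A : FlipRule) (t : Fin 2) (x : Config N) : Prop :=
  ∀ y, Relation.ReflTransGen (FlipStep A) x y → countStatus t x ≤ countStatus t y

variable {A : FlipRule} {s t : Fin 2} {x : Config N} {i : Fin N}

lemma flipStep_flipAt (h : A (x (i - 1)) (x i) (x (i + 1))) : FlipStep A x (flipAt x i) :=
  ⟨i, h, rfl⟩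

lemma exists_isCountMinimal (A : FlipRule) (t : Fin 2) (x : Config N) :
    ∃ y, Relation.ReflTransGen (FlipStep A) x y ∧ IsCountMinimal A t y :=
  exists_reflTransGen_minimal _ _ x

lemma IsCountMinimal.not_rule (hx : IsCountMinimal A t x) (hi : x i = t) :
    ¬ A (x (i - 1)) t (x (i + 1)) := by
  intro hA
  have hle := hx _ (.single (flipStep_flipAt (i := i) (by rwa [hi])))
  have hlt := countStatus_flipAt_of_eq hi
  omega

lemma IsCountMinimal.eq_const_of_mixed (hx : IsCountMinimal A t x) (hst : s ≠ t)
    (h0 : A s t s) (h3 : A t t t) (h : A s t t ∨ A t t s) : x = fun _ => s := by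
  funext i
  by_contra hi
  replace hi : x i = t := (eq_or_eq_of_ne hst _).resolve_left hi
  have hA := hx.not_rule hi
  rcases eq_or_eq_of_ne hst (x (i - 1)) with hl | hl <;>
    rcases eq_or_eq_of_ne hst (x (i + 1)) with hr | hr <;> rw [hl, hr] at hA
  · exact hA h0
  · have hA' := hx.not_rule hr
    rw [add_sub_cancel_right, hi] at hA'
    rcases eq_or_eq_of_ne hst (x (i + 1 + 1)) with hq | hq <;> rw [hq] at hA' <;> tauto
  · have hA' := hx.not_rule hl
    rw [sub_add_cancel, hi] at hA'
    rcases eq_or_eq_of_ne hst (x (i - 1 - 1)) with hq | hq <;> rw [hq] at hA' <;> tauto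
  · exact hA h3

lemma IsCountMinimal.not_rule_after_pair (hx : IsCountMinimal A t x) (hst : s ≠ t) (hN : 4 ≤ N)
    (h0 : A s t s) (h3 : A t t t) (e0 : x (i - 1 - 1) = s) (e1 : x (i - 1) = t) (e2 : x i = t)
    (e3 : x (i + 1) = s) : ¬ A t s (x (i + 1 + 1)) := by
  intro hA
  have ne_of_sub {a b : Fin N} (k : ℕ) (hk : k ≠ 0) (hk4 : k < 4) (hab : b - a = k • (1 : Fin N)) :
      a ≠ b := fun h => fin_nsmul_one_ne_zero hk (by omega) (hab.symm.trans (by rw [h, sub_self]))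
  have ne01 : i - 1 - 1 ≠ i - 1 := ne_of_sub 1 (by omega) (by omega) (by abel)
  have ne02 : i - 1 - 1 ≠ i := ne_of_sub 2 (by omega) (by omega) (by abel)
  have ne03 : i - 1 - 1 ≠ i + 1 := ne_of_sub 3 (by omega) (by omega) (by abel)
  have ne12 : i - 1 ≠ i := ne_of_sub 1 (by omega) (by omega) (by abel)
  have ne13 : i - 1 ≠ i + 1 := ne_of_sub 2 (by omega) (by omega) (by abel)
  have ne23 : i ≠ i + 1 := ne_of_sub 1 (by omega) (by omega) (by abel)
  have hs : 1 - s = t := one_sub_eq_iff.2 hst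
  have ht : 1 - t = s := one_sub_eq_iff.2 hst.symm
  -- Flipping the players `i + 1`, `i` and `i - 1` in this order leaves one `t` fewer.
  let y := flipAt x (i + 1)
  let z := flipAt y i
  have hy : FlipStep A x y := flipStep_flipAt (by rwa [add_sub_cancel_right, e2, e3])
  have hz : FlipStep A y z := flipStep_flipAt (by
    simpa only [y, flipAt_self, flipAt_of_ne _ ne13, flipAt_of_ne _ ne23, e1, e2, e3, hs] using h3)
  have hw : FlipStep A z (flipAt z (i - 1)) := flipStep_flipAt (by
    simpa only [z, y, sub_add_cancel, flipAt_self, flipAt_of_ne _ ne01, flipAt_of_ne _ ne02,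
      flipAt_of_ne _ ne03, flipAt_of_ne _ ne12, flipAt_of_ne _ ne13, flipAt_of_ne _ ne23,
      e0, e1, e2, ht] using h0)
  have hle := hx _ (((Relation.ReflTransGen.single hy).tail hz).tail hw)
  have cy : countStatus t y = countStatus t x + 1 := countStatus_flipAt_of_ne (e3.trans_ne hst)
  have cz : countStatus t z + 1 = countStatus t y :=
    countStatus_flipAt_of_eq ((flipAt_of_ne _ ne23).trans e2)
  have cw : countStatus t (flipAt z (i - 1)) + 1 = countStatus t z :=
    countStatus_flipAt_of_eq (by simpa only [z, y, flipAt_of_ne _ ne12, flipAt_of_ne _ ne13])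
  omega

lemma IsCountMinimal.pair_shift (hx : IsCountMinimal A t x) (hst : s ≠ t) (hN : 4 ≤ N)
    (h0 : A s t s) (h3 : A t t t) (h2 : A t s s) (hl : x (i - 1) = s) (hi : x i = t) :
    ¬ A t s t ∧ x (i + 3 • 1 - 1) = s ∧ x (i + 3 • 1) = t := by
  have hr : x (i + 1) = t :=
    (eq_or_eq_of_ne hst _).resolve_left fun hr => hx.not_rule hi (by rwa [hl, hr])
  have hrr : x (i + 1 + 1) = s :=
    (eq_or_eq_of_ne hst _).resolve_right fun hrr =>
      hx.not_rule hr (by rwa [add_sub_cancel_right, hi, hrr])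
  have hA := hx.not_rule_after_pair (i := i + 1) hst hN h0 h3
    (by rwa [add_sub_cancel_right]) (by rwa [add_sub_cancel_right]) hr hrr
  have hrrr : x (i + 1 + 1 + 1) = t :=
    (eq_or_eq_of_ne hst _).resolve_left fun h => hA (by rwa [h])
  rw [show i + 3 • 1 - 1 = i + 1 + 1 by abel, show i + 3 • 1 = i + 1 + 1 + 1 by abel]
  exact ⟨by rwa [hrrr] at hA, hrr, hrrr⟩

lemma IsCountMinimal.eq_const_of_equal (hx : IsCountMinimal A t x) (hst : s ≠ t) (hN : 4 ≤ N)
    (h0 : A s t s) (h3 : A t t t) (h2 : A t s s) (h : ¬ 3 ∣ N ∨ A t s t) : x = fun _ => s := by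
  by_contra hne
  obtain ⟨j, hj⟩ : ∃ j, x j = t := by
    by_contra! hall
    exact hne (funext fun j => (eq_or_eq_of_ne hst _).resolve_right (hall j))
  obtain ⟨i, hl, hi⟩ : ∃ i, x (i - 1) = s ∧ x i = t := by
    rcases eq_or_eq_of_ne hst (x (j - 1)) with hl | hl
    · exact ⟨j, hl, hj⟩
    · refine ⟨j - 1, (eq_or_eq_of_ne hst _).resolve_right fun hll => hx.not_rule hl ?_, hl⟩
      rwa [hll, sub_add_cancel, hj]
  have h3N : ¬ 3 ∣ N := h.resolve_right (hx.pair_shift hst hN h0 h3 h2 hl hi).1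
  have periodic (k : ℕ) : x (i + k • 3 • 1 - 1) = s ∧ x (i + k • 3 • 1) = t := by
    induction k with
    | zero => simpa using ⟨hl, hi⟩
    | succ k ih =>
      rw [succ_nsmul, ← add_assoc]
      exact (hx.pair_shift hst hN h0 h3 h2 ih.1 ih.2).2
  obtain ⟨k, hk⟩ : ∃ k : ℕ, k • 3 • (1 : Fin N) = 1 := exists_nsmul_eq_self_of_coprime <| by
    rwa [addOrderOf_fin_one, Nat.prime_three.coprime_iff_not_dvd]
  have hs := (periodic k).1
  rw [hk, add_sub_cancel_right, hi] at hs
  exact hst hs.symm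

lemma exists_forall_reach_of_rule (hN : 3 ≤ N) (hst : s ≠ t) (hA : ∀ l r, A l s r ∨ A l t r)
    (h0 : A s t s) (h3 : A t t t) (hdvd : 3 ∣ N → A s t t ∨ A t t s ∨ A t s t)
    (hthree : N = 3 → A s t t ∨ A t t s ∨ A s s s) :
    ∃ z : Config N, ∀ x, Relation.ReflTransGen (FlipStep A) x z := by
  suffices hconst : (∀ x : Config N, IsCountMinimal A t x → x = fun _ => s) ∨
      ∀ x : Config N, IsCountMinimal A s x → x = fun _ => t by
    rcases hconst with hconst | hconst
    · refine ⟨fun _ => s, fun x => ?_⟩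
      obtain ⟨y, hxy, hy⟩ := exists_isCountMinimal A t x
      exact hconst y hy ▸ hxy
    · refine ⟨fun _ => t, fun x => ?_⟩
      obtain ⟨y, hxy, hy⟩ := exists_isCountMinimal A s x
      exact hconst y hy ▸ hxy
  by_cases hmixed : A s t t ∨ A t t s
  · exact .inl fun x hx => hx.eq_const_of_mixed hst h0 h3 hmixed
  have hts : A t s s := (hA t s).resolve_right fun h => hmixed (.inr h)
  by_cases hequal : 4 ≤ N ∧ (¬ 3 ∣ N ∨ A t s t)
  · exact .inl fun x hx => hx.eq_const_of_equal hst hequal.1 h0 h3 hts hequal.2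
  have htst : 3 ∣ N → A t s t := by tauto
  obtain rfl : N = 3 := by
    by_contra hN3
    exact hequal ⟨by omega, by tauto⟩
  have hsss : A s s s := by tauto
  exact .inr fun x hx => hx.eq_const_of_mixed hst.symm (htst dvd_rfl) hsss (.inl hts)

/-- Every player met on going around the circle in steps of `d`, starting from `0`, has the status
opposite to that of the preceding one. The last and the first player may agree. -/
def IsAlternating (d : Fin N) (x : Config N) : Prop :=
  ∀ k, k + 1 < N → x ((k + 1) • d) = 1 - x (k • d)

lemma IsAlternating.apply_nsmul {d : Fin N} (hx : IsAlternating d x) {k : ℕ} (hk : k < N) :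
    x (k • d) = if Even k then x 0 else 1 - x 0 := by
  induction k with
  | zero => simp
  | succ k ih =>
    rw [hx k hk, ih (by omega)]
    by_cases hk : Even k <;> simp [hk, Nat.even_add_one]

lemma IsAlternating.eq {d : Fin N} (hd : addOrderOf d = N) (hx : IsAlternating d x)
    {y : Config N} (hy : IsAlternating d y) (hxy : x 0 = y 0) : x = y := by
  funext j
  obtain ⟨k, hk, rfl⟩ := exists_nsmul_eq_of_addOrderOf_eq_card (d := d) (by simpa using hd) j
  rw [Nat.card_fin] at hk
  rw [hx.apply_nsmul hk, hy.apply_nsmul hk, hxy]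

lemma exists_reach_isAlternating {r : Config N → Config N → Prop} {d : Fin N}
    (hd : addOrderOf d = N) (hr : ∀ x i, x i = x (i + d) → r x (flipAt x (i + d)))
    (x : Config N) : ∃ y, Relation.ReflTransGen r x y ∧ y 0 = x 0 ∧ IsAlternating d y := by
  have partially (n : ℕ) : ∃ y, Relation.ReflTransGen r x y ∧ y 0 = x 0 ∧
      ∀ k < n, k + 1 < N → y ((k + 1) • d) = 1 - y (k • d) := by
    induction n with
    | zero => exact ⟨x, .refl, rfl, by omega⟩
    | succ n ih =>
      obtain ⟨y, hxy, hy0, hy⟩ := ih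
      by_cases hn : n + 1 < N ∧ y (n • d) = y (n • d + d)
      · rw [← succ_nsmul] at hn
        have hne {k : ℕ} (hk : k < n + 1) : k • d ≠ (n + 1) • d := fun h =>
          hk.ne (nsmul_injOn_Iio_addOrderOf (by simp [hd]; omega) (by simp [hd]; omega) h)
        refine ⟨flipAt y ((n + 1) • d), hxy.tail ?_, ?_, fun k hk hkN => ?_⟩
        · rw [succ_nsmul] at hn ⊢
          exact hr y _ hn.2
        · rw [flipAt_of_ne _ (by simpa using hne n.succ_pos), hy0]
        · rcases Nat.lt_succ_iff_lt_or_eq.1 hk with hk | rfl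
          · rw [flipAt_of_ne _ (hne (by omega)), flipAt_of_ne _ (hne (by omega)), hy k hk hkN]
          · rw [flipAt_self, flipAt_of_ne _ (hne k.lt_succ_self), hn.2]
      · refine ⟨y, hxy, hy0, fun k hk hkN => ?_⟩
        rcases Nat.lt_succ_iff_lt_or_eq.1 hk with hk | rfl
        · exact hy k hk hkN
        · rw [succ_nsmul, eq_comm, one_sub_eq_iff]
          exact fun h => hn ⟨hkN, h⟩
  obtain ⟨y, hxy, hy0, hy⟩ := partially N
  exact ⟨y, hxy, hy0, fun k hk => hy k (by omega) hk⟩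

/-- For odd `N` the last player and the first one agree once the others alternate, so the first one
can be flipped too. -/
lemma exists_forall_reach_of_odd (hN : Odd N) {r : Config N → Config N → Prop} {d : Fin N}
    (hd : addOrderOf d = N) (hr : ∀ x i, x i = x (i + d) → r x (flipAt x (i + d))) :
    ∃ z, ∀ x, Relation.ReflTransGen r x z := by
  obtain ⟨z, -, hz0, hz⟩ := exists_reach_isAlternating hd hr (fun _ => 0)
  have reach_of_zero (x : Config N) (hx0 : x 0 = 0) : Relation.ReflTransGen r x z := by
    obtain ⟨y, hxy, hy0, hy⟩ := exists_reach_isAlternating hd hr x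
    rwa [← hy.eq hd hz (by rw [hy0, hx0, hz0])]
  refine ⟨z, fun x => ?_⟩
  obtain ⟨y, hxy, -, hy⟩ := exists_reach_isAlternating hd hr x
  rcases eq_or_eq_of_ne zero_ne_one (y 0) with hy0 | hy0
  · exact hxy.trans (reach_of_zero y hy0)
  obtain ⟨n, rfl⟩ := hN
  have hlast : (2 * n) • d + d = 0 := by rw [← succ_nsmul, ← addOrderOf_nsmul_eq_zero d, hd]
  have hyl : y ((2 * n) • d) = y 0 := by simp [hy.apply_nsmul (k := 2 * n) (by omega)]
  have hflip := hr y ((2 * n) • d) (by rw [hlast, hyl])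
  rw [hlast] at hflip
  exact (hxy.tail hflip).trans (reach_of_zero _ (by rw [flipAt_self, hy0, sub_self]))

lemma exists_forall_reach_of_rule_of_odd (hN : Odd N)
    (hA : (∀ a b, A a a b) ∨ ∀ a b, A b a a) :
    ∃ z : Config N, ∀ x, Relation.ReflTransGen (FlipStep A) x z := by
  rcases hA with hA | hA
  · refine exists_forall_reach_of_odd hN addOrderOf_fin_one fun x i hi => flipStep_flipAt ?_
    rw [add_sub_cancel_right, hi]
    exact hA _ _
  · refine exists_forall_reach_of_odd hN ((addOrderOf_neg 1).trans addOrderOf_fin_one)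
      fun x i hi => flipStep_flipAt ?_
    rw [neg_add_cancel_right, hi]
    exact hA _ _

end Reachability

/-- The rule under which a change of status is allowed if it has positive probability, that is,
unless the winning probability makes the present status `0` or `1` certain to be kept. -/
def MayChange (p : Fin 4 → ℝ) : FlipRule := fun l c r =>
  p (pairIndex l r) ≠ if c = 0 then 0 else 1

lemma ErgodicityConditions.exists_forall_reach {N : ℕ} [NeZero N] {p : Fin 4 → ℝ}
    (herg : ErgodicityConditions N p) (hN : 3 ≤ N) :
    ∃ z : Config N, ∀ x, Relation.ReflTransGen (FlipStep (MayChange p)) x z := by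
  obtain ⟨h01, hparity, hall0, hall1, hdvd, hthree⟩ := herg
  have mayChange (l r : Fin 2) : MayChange p l 0 r ∨ MayChange p l 1 r := by
    by_cases h : p (pairIndex l r) = 0 <;> simp [MayChange, h]
  by_cases hlow : p 0 ≠ 1 ∧ p 3 ≠ 1
  · have hdvd1 (h : 3 ∣ N) : p 1 ≠ 1 ∨ p 2 ≠ 1 ∨ p 3 ≠ 0 := by
      by_contra! hp
      exact hdvd ⟨h, .inr hp⟩
    have hthree1 (h : N = 3) : p 1 ≠ 1 ∨ p 2 ≠ 1 ∨ p 0 ≠ 0 := by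
      by_contra! hp
      exact hthree ⟨h, .inl ⟨hp.2.2, hp.1, hp.2.1⟩⟩
    exact exists_forall_reach_of_rule hN zero_ne_one mayChange hlow.1 hlow.2 hdvd1 hthree1
  by_cases hhigh : p 0 ≠ 0 ∧ p 3 ≠ 0
  · have hdvd0 (h : 3 ∣ N) : p 2 ≠ 0 ∨ p 1 ≠ 0 ∨ p 0 ≠ 1 := by
      by_contra! hp
      exact hdvd ⟨h, .inl ⟨hp.2.2, hp.2.1, hp.1⟩⟩
    have hthree0 (h : N = 3) : p 2 ≠ 0 ∨ p 1 ≠ 0 ∨ p 3 ≠ 1 := by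
      by_contra! hp
      exact hthree ⟨h, .inr ⟨hp.2.1, hp.1, hp.2.2⟩⟩
    exact exists_forall_reach_of_rule hN one_ne_zero (fun l r => (mayChange l r).symm)
      hhigh.2 hhigh.1 hdvd0 hthree0
  have h03 : p 0 = 1 ∧ p 3 = 0 := by
    grind
  refine exists_forall_reach_of_rule_of_odd (Nat.not_even_iff_odd.1 fun h => hparity ⟨h, h03⟩) ?_
  have h12 : (p 1 ≠ 0 ∧ p 2 ≠ 1) ∨ (p 2 ≠ 0 ∧ p 1 ≠ 1) := by
    grind
  refine h12.imp ?_ ?_ <;> rintro ⟨h1, h2⟩ a b <;> fin_cases a <;> fin_cases b <;>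
    simp_all [MayChange, pairIndex]

section StochasticMatrix

open scoped Matrix

variable {S : Type*} [Fintype S] {P : Matrix S S ℝ} {ρ : S → ℝ}

lemma IsStationary.dotProduct_mulVec (hρ : IsStationary P ρ) (f : S → ℝ) :
    ρ ⬝ᵥ P *ᵥ f = ρ ⬝ᵥ f := by
  rw [Matrix.dotProduct_mulVec, hρ.2]

lemma IsStationary.dotProduct_one_eq_one (hρ : IsStationary P ρ) : ρ ⬝ᵥ 1 = 1 :=
  (dotProduct_one ρ).trans hρ.1.2

lemma IsStationary.comp_equiv (hρ : IsStationary P ρ) (e : S ≃ S)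
    (he : P.submatrix e e = P) : IsStationary P (ρ ∘ e) := by
  refine ⟨⟨fun x => hρ.1.1 (e x), ?_⟩, ?_⟩
  · simpa only [Function.comp_apply, Equiv.sum_comp e ρ] using hρ.1.2
  · conv_lhs => rw [← he, Matrix.submatrix_vecMul_equiv, Function.comp_assoc,
      Equiv.self_comp_symm, Function.comp_id, hρ.2]

variable [DecidableEq S] {ρ' : S → ℝ} {z : S}

lemma apply_eq_apply_of_harmonic_of_isMax (hP : P ∈ Matrix.rowStochastic ℝ S) {f : S → ℝ}
    (hf : P *ᵥ f = f) {x y : S} (hx : ∀ a, f a ≤ f x) (hxy : 0 < P x y) : f y = f x := by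
  have hsum : ∑ a, P x a * (f x - f a) = 0 := by
    simp only [mul_sub, Finset.sum_sub_distrib, ← Finset.sum_mul,
      Matrix.sum_row_of_mem_rowStochastic hP, one_mul]
    exact sub_eq_zero.2 (congrFun hf x).symm
  have hterm := (Finset.sum_eq_zero_iff_of_nonneg fun a _ =>
    mul_nonneg (hP.1 x a) (sub_nonneg.2 (hx a))).1 hsum y (Finset.mem_univ y)
  linarith [(mul_eq_zero.1 hterm).resolve_left hxy.ne']

lemma le_of_harmonic (hP : P ∈ Matrix.rowStochastic ℝ S)
    (hz : ∀ x, Relation.ReflTransGen (fun x y => 0 < P x y) x z) {f : S → ℝ}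
    (hf : P *ᵥ f = f) (x : S) : f x ≤ f z := by
  have : Nonempty S := ⟨z⟩
  obtain ⟨m, hm⟩ := Finite.exists_max f
  suffices hmz : ∀ y, Relation.ReflTransGen (fun x y => 0 < P x y) m y → f y = f m from
    (hm x).trans_eq (hmz z (hz m)).symm
  intro y hy
  induction hy with
  | refl => rfl
  | tail _ hab ih =>
    exact (apply_eq_apply_of_harmonic_of_isMax hP hf (fun c => ih ▸ hm c) hab).trans ih

lemma eq_of_harmonic (hP : P ∈ Matrix.rowStochastic ℝ S)
    (hz : ∀ x, Relation.ReflTransGen (fun x y => 0 < P x y) x z) {f : S → ℝ}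
    (hf : P *ᵥ f = f) (x : S) : f x = f z :=
  le_antisymm (le_of_harmonic hP hz hf x) <|
    neg_le_neg_iff.1 (le_of_harmonic (f := -f) hP hz (by rw [Matrix.mulVec_neg, hf]) x)

lemma exists_vecMul_eq_self [Nonempty S] (hP : P ∈ Matrix.rowStochastic ℝ S) :
    ∃ v ≠ 0, v ᵥ* P = v := by
  have hdet : (1 - P).det = 0 := Matrix.exists_mulVec_eq_zero_iff.1
    ⟨1, one_ne_zero, by rw [Matrix.sub_mulVec, Matrix.one_mulVec, hP.2, sub_self]⟩
  obtain ⟨v, hv0, hv⟩ := Matrix.exists_vecMul_eq_zero_iff.2 hdet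
  rw [Matrix.vecMul_sub, Matrix.vecMul_one, sub_eq_zero] at hv
  exact ⟨v, hv0, hv.symm⟩

lemma abs_vecMul_eq_abs (hP : P ∈ Matrix.rowStochastic ℝ S) {v : S → ℝ} (hv : v ᵥ* P = v) :
    |v| ᵥ* P = |v| := by
  have hle (y : S) : |v| y ≤ (|v| ᵥ* P) y := by
    conv_lhs => rw [Pi.abs_apply, ← hv]
    refine (Finset.abs_sum_le_sum_abs _ _).trans_eq (Finset.sum_congr rfl fun x _ => ?_)
    rw [abs_mul, abs_of_nonneg (hP.1 x y), Pi.abs_apply]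
  have htotal : |v| ⬝ᵥ 1 = (|v| ᵥ* P) ⬝ᵥ 1 := by rw [← Matrix.dotProduct_mulVec, hP.2]
  rw [dotProduct_one, dotProduct_one] at htotal
  exact funext fun y =>
    ((Finset.sum_eq_sum_iff_of_le fun y _ => hle y).1 htotal y (Finset.mem_univ y)).symm

lemma exists_isStationary [Nonempty S] (hP : P ∈ Matrix.rowStochastic ℝ S) :
    ∃ ρ, IsStationary P ρ := by
  obtain ⟨v, hv0, hv⟩ := exists_vecMul_eq_self hP
  have hpos : 0 < ∑ x, |v| x := by
    obtain ⟨x, hx⟩ := Function.ne_iff.1 hv0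
    exact Finset.sum_pos' (fun _ _ => abs_nonneg _) ⟨x, Finset.mem_univ x, abs_pos.2 hx⟩
  refine ⟨(∑ x, |v| x)⁻¹ • |v|, ⟨fun x => ?_, ?_⟩, ?_⟩
  · exact mul_nonneg (inv_nonneg.2 hpos.le) (abs_nonneg _)
  · simp only [Pi.smul_apply, smul_eq_mul, ← Finset.mul_sum]
    exact inv_mul_cancel₀ hpos.ne'
  · rw [Matrix.smul_vecMul, abs_vecMul_eq_abs hP hv]

lemma IsStationary.exists_poisson (hρ : IsStationary P ρ) (hP : P ∈ Matrix.rowStochastic ℝ S)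
    (hz : ∀ x, Relation.ReflTransGen (fun x y => 0 < P x y) x z) (h : S → ℝ) :
    ∃ g : S → ℝ, g - P *ᵥ g = h - (ρ ⬝ᵥ h) • 1 := by
  -- The fundamental matrix, which is invertible although `1 - P` is not.
  let L : Matrix S S ℝ := 1 - P + Matrix.vecMulVec 1 ρ
  have mulVec_L (g : S → ℝ) : L *ᵥ g = g - P *ᵥ g + (ρ ⬝ᵥ g) • 1 := by
    rw [Matrix.add_mulVec, Matrix.sub_mulVec, Matrix.one_mulVec, Matrix.vecMulVec_mulVec,
      op_smul_eq_smul]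
  have dotProduct_L (g : S → ℝ) : ρ ⬝ᵥ L *ᵥ g = ρ ⬝ᵥ g := by
    rw [mulVec_L, dotProduct_add, dotProduct_sub, hρ.dotProduct_mulVec, dotProduct_smul,
      hρ.dotProduct_one_eq_one, sub_self, zero_add, smul_eq_mul, mul_one]
  have hinj : Function.Injective L.mulVec := by
    refine (injective_iff_map_eq_zero L.mulVecLin).2 fun g hg => ?_
    rw [Matrix.mulVecLin_apply] at hg
    have hmean : ρ ⬝ᵥ g = 0 := by rw [← dotProduct_L, hg, dotProduct_zero]
    rw [mulVec_L, hmean, zero_smul, add_zero, sub_eq_zero] at hg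
    have hconst : g = g z • 1 := funext fun x => by simpa using eq_of_harmonic hP hz hg.symm x
    rw [hconst, dotProduct_smul, hρ.dotProduct_one_eq_one, smul_eq_mul, mul_one] at hmean
    rw [hconst, hmean, zero_smul]
  obtain ⟨g, hg⟩ := Matrix.mulVec_surjective_iff_isUnit.2
    (Matrix.mulVec_injective_iff_isUnit.1 hinj) h
  exact ⟨g, by rw [← hg, dotProduct_L, mulVec_L, add_sub_cancel_right]⟩

lemma IsStationary.unique (hρ : IsStationary P ρ) (hρ' : IsStationary P ρ')
    (hP : P ∈ Matrix.rowStochastic ℝ S)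
    (hz : ∀ x, Relation.ReflTransGen (fun x y => 0 < P x y) x z) : ρ' = ρ := by
  refine dotProduct_eq _ _ fun h => ?_
  obtain ⟨g, hg⟩ := hρ.exists_poisson hP hz h
  have hzero : ρ' ⬝ᵥ (g - P *ᵥ g) = 0 := by
    rw [dotProduct_sub, hρ'.dotProduct_mulVec, sub_self]
  rwa [hg, dotProduct_sub, dotProduct_smul, hρ'.dotProduct_one_eq_one, smul_eq_mul, mul_one,
    sub_eq_zero] at hzero

end StochasticMatrix

section StatusChain

open scoped Matrix

variable {N : ℕ} [NeZero N] {p : Fin 4 → ℝ} {ρ : Config N → ℝ}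

lemma natCast_inv_mul_sum_const (c : ℝ) : (N : ℝ)⁻¹ * ∑ _i : Fin N, c = c := by
  simp [NeZero.ne N]

lemma changeProb_add_stayProb (p : Fin 4 → ℝ) (x : Config N) (i : Fin N) :
    changeProb p x i + stayProb p x i = 1 := by
  unfold changeProb stayProb
  split_ifs <;> ring

lemma changeProb_nonneg (hp : ∀ m, p m ∈ Set.Icc (0 : ℝ) 1) (x : Config N) (i : Fin N) :
    0 ≤ changeProb p x i := by
  unfold changeProb
  split_ifs
  exacts [(hp _).1, sub_nonneg.2 (hp _).2]

lemma stayProb_nonneg (hp : ∀ m, p m ∈ Set.Icc (0 : ℝ) 1) (x : Config N) (i : Fin N) :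
    0 ≤ stayProb p x i := by
  unfold stayProb
  split_ifs
  exacts [sub_nonneg.2 (hp _).2, (hp _).1]

lemma changeProb_pos (hp : ∀ m, p m ∈ Set.Icc (0 : ℝ) 1) {x : Config N} {i : Fin N}
    (h : MayChange p (x (i - 1)) (x i) (x (i + 1))) : 0 < changeProb p x i := by
  refine (changeProb_nonneg hp x i).lt_of_ne' ?_
  unfold changeProb
  unfold MayChange at h
  split_ifs at h ⊢
  exacts [h, sub_ne_zero.2 h.symm]

lemma transP_eq (p : Fin 4 → ℝ) (x y : Config N) :
    transP p x y = (N : ℝ)⁻¹ * ∑ i, ((if y = flipAt x i then changeProb p x i else 0) +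
      if y = x then stayProb p x i else 0) := by
  unfold transP
  split_ifs with h
  · subst h
    simp only [(flipAt_ne y _).symm, if_false, zero_add]
  · simp only [add_zero, Finset.mul_sum, mul_ite, mul_zero]

lemma transP_mulVec (p : Fin 4 → ℝ) (f : Config N → ℝ) (x : Config N) :
    (transP p *ᵥ f) x =
      (N : ℝ)⁻¹ * ∑ i, (changeProb p x i * f (flipAt x i) + stayProb p x i * f x) := by
  simp only [Matrix.mulVec, dotProduct, transP_eq, mul_assoc, ← Finset.mul_sum, Finset.sum_mul]
  rw [Finset.sum_comm]
  simp only [add_mul, ite_mul, zero_mul, Finset.sum_add_distrib, Finset.sum_ite_eq',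
    Finset.mem_univ, if_true]

lemma transP_mem_rowStochastic (hp : ∀ m, p m ∈ Set.Icc (0 : ℝ) 1) :
    transP p ∈ Matrix.rowStochastic ℝ (Config N) := by
  refine ⟨fun x y => ?_, funext fun x => ?_⟩
  · rw [transP_eq]
    refine mul_nonneg (by positivity) (Finset.sum_nonneg fun i _ => add_nonneg ?_ ?_)
    · exact ite_nonneg (changeProb_nonneg hp x i) le_rfl
    · exact ite_nonneg (stayProb_nonneg hp x i) le_rfl
  · simp only [transP_mulVec, Pi.one_apply, mul_one, changeProb_add_stayProb,
      natCast_inv_mul_sum_const]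

lemma transP_pos_of_flipStep (hp : ∀ m, p m ∈ Set.Icc (0 : ℝ) 1) {x y : Config N}
    (h : FlipStep (MayChange p) x y) : 0 < transP p x y := by
  obtain ⟨i, hi, rfl⟩ := h
  have hN : 0 < (N : ℝ)⁻¹ := inv_pos.2 (Nat.cast_pos.2 (NeZero.pos N))
  rw [transP, if_neg (flipAt_ne x i)]
  refine Finset.sum_pos' (fun j _ => ite_nonneg ?_ le_rfl) ⟨i, Finset.mem_univ i, ?_⟩
  · exact mul_nonneg hN.le (changeProb_nonneg hp x j)
  · rw [if_pos rfl]
    exact mul_pos hN (changeProb_pos hp hi)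

lemma ErgodicityConditions.exists_forall_transP_reach (herg : ErgodicityConditions N p)
    (hN : 3 ≤ N) (hp : ∀ m, p m ∈ Set.Icc (0 : ℝ) 1) :
    ∃ z : Config N, ∀ x, Relation.ReflTransGen (fun x y => 0 < transP p x y) x z := by
  obtain ⟨z, hz⟩ := herg.exists_forall_reach hN
  exact ⟨z, fun x => (hz x).lift id fun _ _ => transP_pos_of_flipStep hp⟩

/-- The rotation of the circle that moves the player in position `i + c` to position `i`. -/
def rotate (c : Fin N) : Config N ≃ Config N :=
  (Equiv.addRight c).symm.arrowCongr (Equiv.refl (Fin 2))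

@[simp] lemma rotate_apply (c : Fin N) (x : Config N) (i : Fin N) :
    rotate c x i = x (i + c) := rfl

lemma flipAt_rotate (c : Fin N) (x : Config N) (i : Fin N) :
    flipAt (rotate c x) i = rotate c (flipAt x (i + c)) := by
  funext j
  rcases eq_or_ne j i with rfl | h
  · simp
  · rw [flipAt_of_ne _ h, rotate_apply, rotate_apply, flipAt_of_ne _ (by simpa using h)]

lemma nbrIndex_rotate (c : Fin N) (x : Config N) (i : Fin N) :
    nbrIndex (rotate c x) i = nbrIndex x (i + c) := by
  simp only [nbrIndex, rotate_apply, sub_add_eq_add_sub, add_right_comm]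

lemma transP_submatrix_rotate (p : Fin 4 → ℝ) (c : Fin N) :
    (transP p).submatrix (rotate c) (rotate c) = transP p := by
  ext x y
  rw [Matrix.submatrix_apply, transP_eq, transP_eq]
  refine congrArg _ (Eq.trans ?_ (Equiv.sum_comp (Equiv.addRight c) _))
  simp only [flipAt_rotate, (rotate c).apply_eq_iff_eq, Equiv.coe_addRight, changeProb, stayProb,
    nbrIndex_rotate, rotate_apply]
  congr!

/-- Mean payoff to player `i` from playing in configuration `x`. -/
noncomputable def expectedPayoff (p : Fin 4 → ℝ) (x : Config N) (i : Fin N) : ℝ :=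
  p (nbrIndex x i) - (1 - p (nbrIndex x i))

/-- Mean payoff to player `i` from playing when the configuration has law `ρ`. -/
noncomputable def playerProfit (p : Fin 4 → ℝ) (ρ : Config N → ℝ) (i : Fin N) : ℝ :=
  ∑ x, ρ x * expectedPayoff p x i

lemma meanProfit_eq_average (p : Fin 4 → ℝ) (ρ : Config N → ℝ) :
    meanProfit p ρ = (N : ℝ)⁻¹ * ∑ i, playerProfit p ρ i := by
  simp only [playerProfit, Finset.sum_comm (s := Finset.univ (α := Fin N)), ← Finset.mul_sum]
  rfl

lemma meanProfit_eq_playerProfit (hρ : ∀ c, ρ ∘ rotate c = ρ) (p : Fin 4 → ℝ) (i : Fin N) :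
    meanProfit p ρ = playerProfit p ρ i := by
  have hconst (j : Fin N) : playerProfit p ρ j = playerProfit p ρ i := by
    unfold playerProfit
    rw [← Equiv.sum_comp (rotate (i - j))]
    simp only [expectedPayoff, nbrIndex_rotate, add_sub_cancel, ← Function.comp_apply (f := ρ), hρ]
  simp only [meanProfit_eq_average, hconst, natCast_inv_mul_sum_const]

lemma marginalPair_add_eq (hρ : ∀ c, ρ ∘ rotate c = ρ) (i j k : Fin N) (u v : Fin 2) :
    marginalPair ρ i (i + k) u v = marginalPair ρ j (j + k) u v := by
  unfold marginalPair
  rw [← Equiv.sum_comp (rotate (j - i))]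
  simp only [rotate_apply, add_right_comm i k, add_sub_cancel, ← Function.comp_apply (f := ρ), hρ]

lemma sum_mul_apply_eq_sum_marginal {N : ℕ} (ρ : Config N → ℝ) (i : Fin N) (F : Fin 2 → ℝ) :
    ∑ x, ρ x * F (x i) = ∑ u, marginal ρ i u * F u := by
  simp only [marginal, Finset.sum_mul, ite_mul, zero_mul]
  rw [Finset.sum_comm]
  simp

lemma sum_mul_apply_eq_sum_marginalPair {N : ℕ} (ρ : Config N → ℝ) (i j : Fin N)
    (F : Fin 2 → Fin 2 → ℝ) :
    ∑ x, ρ x * F (x i) (x j) = ∑ u, ∑ v, marginalPair ρ i j u v * F u v := by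
  simp only [marginalPair, Finset.sum_mul, ite_mul, zero_mul]
  rw [Finset.sum_comm_cycle]
  simp [ite_and]

lemma playerProfit_add_one (p : Fin 4 → ℝ) (ρ : Config N → ℝ) (i : Fin N) :
    playerProfit p ρ (i + 1) = ∑ u : Fin 2, ∑ v : Fin 2, marginalPair ρ i (i + 2) u v *
      (p (pairIndex u v) - (1 - p (pairIndex u v))) := by
  have htwo : i + 1 + 1 = i + 2 := by
    rw [add_assoc]
    congr 1
    ext
    simp [Fin.val_add]
  rw [← sum_mul_apply_eq_sum_marginalPair ρ i (i + 2) fun u v =>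
    p (pairIndex u v) - (1 - p (pairIndex u v))]
  simp only [playerProfit, expectedPayoff, nbrIndex, add_sub_cancel_right, htwo]

/-- Only the turns of player `i` affect this player's status, and such a turn leads to status `1`
exactly if it is won. -/
lemma transP_mulVec_status (p : Fin 4 → ℝ) (i : Fin N) :
    (transP p *ᵥ fun x => ((x i : ℕ) : ℝ)) =
      fun x => (x i : ℕ) + (N : ℝ)⁻¹ * (p (nbrIndex x i) - (x i : ℕ)) := by
  funext x
  have hterm (j : Fin N) :
      changeProb p x j * ((flipAt x j i : ℕ) : ℝ) + stayProb p x j * (x i : ℕ) =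
        (x i : ℕ) + if j = i then p (nbrIndex x i) - (x i : ℕ) else 0 := by
    rcases eq_or_ne j i with rfl | hj
    · rcases eq_or_eq_of_ne zero_ne_one (x j) with h | h <;> simp [h, changeProb, stayProb]
    · rw [flipAt_of_ne x hj.symm, ← add_mul, changeProb_add_stayProb, one_mul, if_neg hj, add_zero]
  simp only [transP_mulVec, hterm, Finset.sum_add_distrib, mul_add, natCast_inv_mul_sum_const,
    Finset.sum_ite_eq', Finset.mem_univ, if_true]

lemma IsStationary.sum_mul_win (hρ : IsStationary (transP p) ρ) (i : Fin N) :
    ∑ x, ρ x * p (nbrIndex x i) = marginal ρ i 1 := by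
  have hbalance : (N : ℝ)⁻¹ * ∑ x, ρ x * (p (nbrIndex x i) - (x i : ℕ)) = 0 := by
    have h := hρ.dotProduct_mulVec fun x => ((x i : ℕ) : ℝ)
    simpa only [transP_mulVec_status, dotProduct, mul_add, Finset.sum_add_distrib,
      add_eq_left, mul_left_comm _ (N : ℝ)⁻¹, ← Finset.mul_sum] using h
  have hzero := (mul_eq_zero.1 hbalance).resolve_left (by simp [NeZero.ne N])
  simp only [mul_sub, Finset.sum_sub_distrib, sub_eq_zero] at hzero
  rw [hzero, sum_mul_apply_eq_sum_marginal ρ i fun u => ((u : ℕ) : ℝ)]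
  simp

lemma IsStationary.playerProfit_eq (hρ : IsStationary (transP p) ρ) (i : Fin N) :
    playerProfit p ρ i = marginal ρ i 1 - marginal ρ i 0 := by
  have htotal : marginal ρ i 0 + marginal ρ i 1 = ∑ x, ρ x := by
    simpa using (sum_mul_apply_eq_sum_marginal ρ i fun _ => 1).symm
  calc playerProfit p ρ i = 2 * ∑ x, ρ x * p (nbrIndex x i) - ∑ x, ρ x := by
        rw [Finset.mul_sum, ← Finset.sum_sub_distrib]
        exact Finset.sum_congr rfl fun x _ => by rw [expectedPayoff]; ring
    _ = marginal ρ i 1 - marginal ρ i 0 := by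
        rw [hρ.sum_mul_win, ← htotal]
        ring

end StatusChain

section Limits

open Asymptotics

variable {α : Type*} [MeasurableSpace α] {μ : Measure α}

lemma ae_tendsto_zero_of_summable_integral_norm {E : Type*} [NormedAddCommGroup E]
    {f : ℕ → α → E} (hf : ∀ n, Integrable (f n) μ) (hsum : Summable fun n => ∫ x, ‖f n x‖ ∂μ) :
    ∀ᵐ x ∂μ, Tendsto (fun n => f n x) atTop (𝓝 0) := by
  have htsum : ∑' n, eLpNorm (f n) 1 μ ≠ ⊤ := by
    simpa only [eLpNorm_one_eq_lintegral_enorm, ← ofReal_integral_norm_eq_lintegral_enorm (hf _)]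
      using hsum.tsum_ofReal_ne_top
  filter_upwards [summable_norm_of_tsum_eLpNorm_ne_top le_rfl
    (fun n => (hf n).aestronglyMeasurable) htsum] with x hx
  exact tendsto_zero_iff_norm_tendsto_zero.2 hx.tendsto_atTop_zero

lemma tendsto_natSqrt_atTop : Tendsto Nat.sqrt atTop atTop :=
  tendsto_atTop.2 fun b => eventually_atTop.2 ⟨b * b, fun _ h => Nat.le_sqrt.2 h⟩

lemma isLittleO_natSqrt : (fun n : ℕ => (n.sqrt : ℝ)) =o[atTop] fun n => (n : ℝ) := by
  have hpow : (fun k : ℕ => (k : ℝ)) =o[atTop] fun k => (k : ℝ) ^ 2 := by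
    simpa [Function.comp_def] using
      (isLittleO_pow_pow_atTop_of_lt (𝕜 := ℝ) one_lt_two).comp_tendsto tendsto_natCast_atTop_atTop
  refine (hpow.comp_tendsto tendsto_natSqrt_atTop).trans_le fun n => ?_
  simpa using mod_cast n.sqrt_le'

lemma isLittleO_of_isLittleO_sq {E : Type*} [SeminormedAddCommGroup E] {a : ℕ → E} {K : ℝ}
    (hK : ∀ n, ‖a (n + 1) - a n‖ ≤ K)
    (ha : (fun k => a (k ^ 2)) =o[atTop] fun k : ℕ => (k : ℝ) ^ 2) :
    a =o[atTop] fun n => (n : ℝ) := by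
  have hsquare : (fun n : ℕ => a (n.sqrt ^ 2)) =o[atTop] fun n => (n : ℝ) :=
    (ha.comp_tendsto tendsto_natSqrt_atTop).trans_le fun n => by simpa using mod_cast n.sqrt_le'
  have hincrement (n : ℕ) : ‖a n - a (n.sqrt ^ 2)‖ ≤ 2 * K * ‖(n.sqrt : ℝ)‖ := by
    have hgap : n - n.sqrt ^ 2 ≤ 2 * n.sqrt := by
      have := n.sqrt_le_add
      have := sq n.sqrt
      omega
    calc ‖a n - a (n.sqrt ^ 2)‖ ≤ (n - n.sqrt ^ 2 : ℕ) * K := by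
          rw [← dist_eq_norm, dist_comm]
          simpa using dist_le_Ico_sum_of_dist_le (f := a) n.sqrt_le' (d := fun _ => K)
            fun _ _ => by rw [dist_comm, dist_eq_norm]; exact hK _
      _ ≤ (2 * n.sqrt : ℕ) * K := by
          have := (norm_nonneg _).trans (hK 0)
          gcongr
      _ = 2 * K * ‖(n.sqrt : ℝ)‖ := by
          rw [Real.norm_natCast]
          push_cast
          ring
  simpa using hsquare.add ((IsBigO.of_bound _ (.of_forall hincrement)).trans_isLittleO
    isLittleO_natSqrt)

lemma integral_sum_sq_of_orthogonal {ι : Type*} {D : ι → α → ℝ} (hD : ∀ i, MemLp (D i) 2 μ)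
    (horth : Pairwise fun i j => ∫ x, D i x * D j x ∂μ = 0) (s : Finset ι) :
    ∫ x, (∑ i ∈ s, D i x) ^ 2 ∂μ = ∑ i ∈ s, ∫ x, D i x ^ 2 ∂μ := by
  have hint (i j : ι) : Integrable (fun x => D i x * D j x) μ := (hD i).integrable_mul (hD j)
  simp only [sq, Finset.sum_mul_sum]
  rw [integral_finsetSum _ fun i _ => integrable_finsetSum _ fun j _ => hint i j]
  refine Finset.sum_congr rfl fun i hi => ?_
  rw [integral_finsetSum _ fun j _ => hint i j]
  exact Finset.sum_eq_single_of_mem i hi fun j _ hj => horth hj.symm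

theorem ae_isLittleO_sum_of_orthogonal [IsFiniteMeasure μ] {D : ℕ → α → ℝ} {K : ℝ}
    (hmeas : ∀ k, AEStronglyMeasurable (D k) μ) (hK : ∀ k x, |D k x| ≤ K)
    (horth : Pairwise fun i j => ∫ x, D i x * D j x ∂μ = 0) :
    ∀ᵐ x ∂μ, (fun n => ∑ k ∈ Finset.range n, D k x) =o[atTop] fun n : ℕ => (n : ℝ) := by
  have hD (k : ℕ) : MemLp (D k) 2 μ := .of_bound (hmeas k) K (ae_of_all _ (hK k))
  have hvar (n : ℕ) :
      ∫ x, (∑ k ∈ Finset.range n, D k x) ^ 2 ∂μ ≤ n * (K ^ 2 * μ.real Set.univ) := by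
    rw [integral_sum_sq_of_orthogonal hD horth]
    refine (Finset.sum_le_card_nsmul _ _ (K ^ 2 * μ.real Set.univ) fun k _ => ?_).trans_eq (by simp)
    refine (integral_mono (hD k).integrable_sq (integrable_const (K ^ 2)) fun x =>
      sq_le_sq.2 ((hK k x).trans (le_abs_self K))).trans_eq (by simp [mul_comm])
  set Z : ℕ → α → ℝ := fun k x => (∑ j ∈ Finset.range (k ^ 2), D j x) ^ 2 / ((k : ℝ) ^ 2) ^ 2
  have hZint (k : ℕ) : Integrable (Z k) μ :=
    (memLp_finsetSum _ fun j _ => hD j).integrable_sq.div_const _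
  have hZsum : Summable fun k => ∫ x, ‖Z k x‖ ∂μ := by
    refine .of_nonneg_of_le (fun k => by positivity) (fun k => ?_)
      ((Real.summable_nat_pow_inv.2 one_lt_two).mul_left (K ^ 2 * μ.real Set.univ))
    calc ∫ x, ‖Z k x‖ ∂μ
        = (∫ x, (∑ j ∈ Finset.range (k ^ 2), D j x) ^ 2 ∂μ) / ((k : ℝ) ^ 2) ^ 2 := by
          rw [← integral_div]
          exact integral_congr_ae (ae_of_all _ fun x => Real.norm_of_nonneg (by positivity))
      _ ≤ (k ^ 2 : ℕ) * (K ^ 2 * μ.real Set.univ) / ((k : ℝ) ^ 2) ^ 2 := by gcongr; exact hvar _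
      _ = K ^ 2 * μ.real Set.univ * ((k : ℝ) ^ 2)⁻¹ := by
          rcases eq_or_ne k 0 with rfl | hk
          · simp
          · push_cast
            field_simp
  filter_upwards [ae_tendsto_zero_of_summable_integral_norm hZint hZsum] with x hx
  refine isLittleO_of_isLittleO_sq (K := K) (fun n => ?_) ?_
  · simpa [Finset.sum_range_succ] using hK n x
  · exact .of_pow ((isLittleO_iff_tendsto (by simp)).2 hx) two_ne_zero

lemma tendsto_div_of_monotone {a : ℝ≥0 → ℝ} {l : ℝ} (hmono : Monotone a)
    (ha : Tendsto (fun n : ℕ => a n / n) atTop (𝓝 l)) :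
    Tendsto (fun t => a t / t) atTop (𝓝 l) := by
  have hcoe : Tendsto ((↑) : ℝ≥0 → ℝ) atTop atTop := NNReal.tendsto_coe_atTop.2 tendsto_id
  have hfloor : Tendsto (fun t : ℝ≥0 => a ⌊(t : ℝ)⌋₊ / t) atTop (𝓝 l) := by
    have h := (ha.comp (tendsto_nat_floor_atTop.comp hcoe)).mul
      (tendsto_nat_floor_div_atTop.comp hcoe)
    rw [mul_one] at h
    refine h.congr' ?_
    filter_upwards [eventually_ge_atTop 1] with t ht
    have : (⌊(t : ℝ)⌋₊ : ℝ) ≠ 0 := by positivity [Nat.floor_pos.2 ht]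
    simp only [Function.comp_apply]
    field_simp
  have hceil : Tendsto (fun t : ℝ≥0 => a ⌈(t : ℝ)⌉₊ / t) atTop (𝓝 l) := by
    have h := (ha.comp (tendsto_nat_ceil_atTop.comp hcoe)).mul
      (tendsto_nat_ceil_div_atTop.comp hcoe)
    rw [mul_one] at h
    refine h.congr' ?_
    filter_upwards [eventually_gt_atTop 0] with t ht
    have : (⌈(t : ℝ)⌉₊ : ℝ) ≠ 0 := by positivity [Nat.ceil_pos.2 ht]
    simp only [Function.comp_apply]
    field_simp
  refine tendsto_of_tendsto_of_tendsto_of_le_of_le hfloor hceil (fun t => ?_) fun t => ?_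
  · exact div_le_div_of_nonneg_right (hmono (Nat.floor_le t.coe_nonneg)) t.coe_nonneg
  · exact div_le_div_of_nonneg_right (hmono (Nat.le_ceil t)) t.coe_nonneg

lemma tendsto_inv_mul_comp_of_tendsto_div {a : ℕ → ℝ} {T : ℝ≥0 → ℕ} {l r : ℝ} (hr : 0 < r)
    (ha : Tendsto (fun n : ℕ => (n : ℝ)⁻¹ * a n) atTop (𝓝 l))
    (hT : Tendsto (fun t : ℝ≥0 => (T t : ℝ) / t) atTop (𝓝 r)) :
    Tendsto (fun t : ℝ≥0 => (t : ℝ)⁻¹ * a (T t)) atTop (𝓝 (r * l)) := by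
  have hcoe : Tendsto ((↑) : ℝ≥0 → ℝ) atTop atTop := NNReal.tendsto_coe_atTop.2 tendsto_id
  have hTtop : Tendsto T atTop atTop := by
    refine tendsto_natCast_atTop_iff.1 ((hT.pos_mul_atTop hr hcoe).congr' ?_)
    filter_upwards [eventually_gt_atTop 0] with t ht
    exact div_mul_cancel₀ _ (NNReal.coe_ne_zero.2 ht.ne')
  refine (hT.mul (ha.comp hTtop)).congr' ?_
  filter_upwards [hTtop.eventually_gt_atTop 0] with t ht
  have : (T t : ℝ) ≠ 0 := Nat.cast_ne_zero.2 ht.ne'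
  simp only [Function.comp_apply]
  field_simp

end Limits

section Poisson

lemma hasSum_poisson_mul_id (r : ℝ≥0) :
    HasSum (fun n : ℕ => Real.exp (-r) * (r : ℝ) ^ n / n.factorial * n) r := by
  rw [← hasSum_nat_add_iff' 1]
  convert! (hasSum_one_poissonMeasure r).mul_left (r : ℝ) using 1
  · ext n
    rw [Nat.factorial_succ]
    push_cast
    field_simp
    ring
  · simp

lemma integrable_natCast_poissonMeasure (r : ℝ≥0) :
    Integrable (fun n : ℕ => (n : ℝ)) (poissonMeasure r) := by
  simpa [integrable_poissonMeasure_iff] using (hasSum_poisson_mul_id r).summable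

lemma integral_natCast_poissonMeasure (r : ℝ≥0) : ∫ n : ℕ, (n : ℝ) ∂poissonMeasure r = r :=
  (integral_poissonMeasure r _).trans (hasSum_poisson_mul_id r).tsum_eq

theorem IsPoissonProcess.ae_tendsto_div {Ω : Type*} [MeasurableSpace Ω] {Pr : Measure Ω}
    {T : ℝ≥0 → Ω → ℕ} {r : ℝ≥0} (h : IsPoissonProcess r T Pr) :
    ∀ᵐ ω ∂Pr, Tendsto (fun t : ℝ≥0 => (T t ω : ℝ) / t) atTop (𝓝 r) := by
  set D : ℕ → Ω → ℕ := fun k ω => T ((k + 1 : ℕ) : ℝ≥0) ω - T k ω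
  have hmeas (k : ℕ) : Measurable (D k) := (h.measurable _).sub (h.measurable _)
  have hlaw (k : ℕ) : Pr.map (D k) = poissonMeasure r := by
    simpa [D] using h.law k (k + 1 : ℕ) (by simp)
  have hmean : ∫ ω, (D 0 ω : ℝ) ∂Pr = r := by
    rw [← integral_natCast_poissonMeasure, ← hlaw 0,
      integral_map (hmeas 0).aemeasurable .of_discrete]
  have hint : Integrable (fun ω => (D 0 ω : ℝ)) Pr := by
    have := integrable_natCast_poissonMeasure r
    rw [← hlaw 0] at this
    exact this.comp_measurable (hmeas 0)
  have hindep : Pairwise fun i j => IndepFun (fun ω => (D i ω : ℝ)) (fun ω => (D j ω : ℝ)) Pr :=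
    fun i j hij => ((h.indep.nat Nat.mono_cast).indepFun hij).comp .of_discrete .of_discrete
  have hident (k : ℕ) :
      IdentDistrib (fun ω => (D k ω : ℝ)) (fun ω => (D 0 ω : ℝ)) Pr Pr :=
    IdentDistrib.comp ⟨(hmeas k).aemeasurable, (hmeas 0).aemeasurable, by rw [hlaw, hlaw]⟩
      .of_discrete
  filter_upwards [strong_law_ae_real _ hint hindep hident, h.zero, h.monotone]
    with ω hlln hzero hmono
  rw [hmean] at hlln
  refine tendsto_div_of_monotone (a := fun t => (T t ω : ℝ))
    (fun s t hst => Nat.cast_le.2 (hmono hst)) ?_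
  refine hlln.congr fun n => ?_
  rw [← Nat.cast_sum, Finset.sum_range_tsub (f := fun k : ℕ => T k ω)
    fun i j hij => hmono (mod_cast hij), Nat.cast_zero, hzero, Nat.sub_zero]

end Poisson

section MarkovChain

open Asymptotics

variable {Ω S : Type*} [MeasurableSpace Ω] [MeasurableSpace S] {Pr : Measure Ω}
  {P : Matrix S S ℝ} {X : ℕ → Ω → S}

lemma IsMarkovChain.measureReal_path (h : IsMarkovChain P X Pr) {n : ℕ} (a : Fin (n + 1) → S)
    (b : S) :
    Pr.real {ω | (∀ k : Fin (n + 1), X k ω = a k) ∧ X (n + 1) ω = b} =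
      Pr.real {ω | ∀ k : Fin (n + 1), X k ω = a k} * P (a (Fin.last n)) b := by
  have hpath (m : ℕ) (c : ℕ → S) (ω : Ω) :
      (∀ k ≤ m, X k ω = c k) ↔ ∀ k : Fin (m + 1), X k ω = c k := by
    simp only [Fin.forall_iff, Nat.lt_succ_iff]
  simpa [hpath, Fin.forall_fin_succ' (n := n + 1), Fin.is_le, Fin.last] using
    h.markov n fun k => if hk : k < n + 1 then a ⟨k, hk⟩ else b

variable [Fintype S] [MeasurableSingletonClass S] [IsFiniteMeasure Pr]

lemma IsMarkovChain.integral_path (h : IsMarkovChain P X Pr) (n : ℕ)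
    (F : (Fin (n + 1) → S) → S → ℝ) :
    ∫ ω, F (fun k => X k ω) (X (n + 1) ω) ∂Pr =
      ∑ a : Fin (n + 1) → S, Pr.real {ω | ∀ k : Fin (n + 1), X k ω = a k} *
        ∑ b, P (a (Fin.last n)) b * F a b := by
  set Y : Ω → (Fin (n + 1) → S) × S := fun ω => (fun k => X k ω, X (n + 1) ω)
  have hY : Measurable Y :=
    (measurable_pi_lambda _ fun k : Fin (n + 1) => h.measurable k).prodMk (h.measurable _)
  have hlaw (a : Fin (n + 1) → S) (b : S) : (Pr.map Y).real {(a, b)} =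
      Pr.real {ω | ∀ k : Fin (n + 1), X k ω = a k} * P (a (Fin.last n)) b := by
    rw [map_measureReal_apply hY (measurableSet_singleton _), ← h.measureReal_path]
    congr 1
    ext ω
    simp [Y, funext_iff]
  calc ∫ ω, F (fun k => X k ω) (X (n + 1) ω) ∂Pr = ∫ q, F q.1 q.2 ∂Pr.map Y :=
        (integral_map (f := fun q => F q.1 q.2) hY.aemeasurable .of_discrete).symm
    _ = _ := by
        rw [integral_fintype .of_finite, Fintype.sum_prod_type]
        simp only [hlaw, smul_eq_mul, Finset.mul_sum, mul_assoc]

lemma IsMarkovChain.integral_mul_eq_zero (h : IsMarkovChain P X Pr) {d : S → S → ℝ}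
    (hd : ∀ a, ∑ b, P a b * d a b = 0) {j n : ℕ} (hj : j < n) :
    ∫ ω, d (X j ω) (X (j + 1) ω) * d (X n ω) (X (n + 1) ω) ∂Pr = 0 := by
  refine (h.integral_path n fun a b =>
    d (a ⟨j, by omega⟩) (a ⟨j + 1, by omega⟩) * d (a (Fin.last n)) b).trans ?_
  simp only [mul_left_comm (P _ _), ← Finset.mul_sum, hd, mul_zero, Finset.sum_const_zero]

lemma IsMarkovChain.ae_isLittleO_sum (h : IsMarkovChain P X Pr) {d : S → S → ℝ}
    (hd : ∀ a, ∑ b, P a b * d a b = 0) :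
    ∀ᵐ ω ∂Pr, (fun n => ∑ k ∈ Finset.range n, d (X k ω) (X (k + 1) ω)) =o[atTop]
      fun n : ℕ => (n : ℝ) := by
  obtain ⟨K, hK⟩ := Finite.exists_le fun q : S × S => |d q.1 q.2|
  refine ae_isLittleO_sum_of_orthogonal (fun k => ?_) (fun k ω => hK (X k ω, X (k + 1) ω)) ?_
  · exact ((Measurable.of_discrete (f := fun q : S × S => d q.1 q.2)).comp
      ((h.measurable k).prodMk (h.measurable (k + 1)))).aestronglyMeasurable
  · intro j n hjn
    rcases hjn.lt_or_gt with hlt | hlt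
    · exact h.integral_mul_eq_zero hd hlt
    · simpa only [mul_comm] using h.integral_mul_eq_zero hd hlt

theorem IsMarkovChain.ae_tendsto_average (h : IsMarkovChain P X Pr) {w : S → S → ℝ} {g : S → ℝ}
    {μ : ℝ} (hd : ∀ a, ∑ b, P a b * (w a b - μ + g b - g a) = 0) :
    ∀ᵐ ω ∂Pr, Tendsto (fun n : ℕ => (n : ℝ)⁻¹ * ∑ k ∈ Finset.range n, w (X k ω) (X (k + 1) ω))
      atTop (𝓝 μ) := by
  filter_upwards [h.ae_isLittleO_sum hd] with ω hω
  obtain ⟨K, hK⟩ := Finite.exists_le fun a => |g a|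
  have hboundary : (fun n => g (X n ω) - g (X 0 ω)) =o[atTop] fun n : ℕ => (n : ℝ) := by
    refine IsBigO.trans_isLittleO (.of_bound (K + K) (.of_forall fun n => ?_))
      ((isLittleO_one_left_iff ℝ).2 (tendsto_norm_atTop_atTop.comp tendsto_natCast_atTop_atTop))
    simpa using (norm_sub_le (g (X n ω)) (g (X 0 ω))).trans (add_le_add (hK _) (hK _))
  have hsum (n : ℕ) :
      (∑ k ∈ Finset.range n, (w (X k ω) (X (k + 1) ω) - μ + g (X (k + 1) ω) - g (X k ω))) -
          (g (X n ω) - g (X 0 ω)) =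
        ∑ k ∈ Finset.range n, w (X k ω) (X (k + 1) ω) - n * μ := by
    rw [← Finset.sum_range_sub fun k => g (X k ω)]
    simp [add_sub_assoc, Finset.sum_add_distrib]
  have hlim := ((hω.sub hboundary).tendsto_div_nhds_zero).add_const μ
  rw [zero_add] at hlim
  refine hlim.congr' ?_
  filter_upwards [eventually_ne_atTop 0] with n hn
  rw [hsum]
  field_simp
  ring

end MarkovChain

section Profit

open scoped Matrix

variable {N : ℕ} {p : Fin 4 → ℝ}

lemma payoff_flipAt (x : Config N) (i j : Fin N) :
    payoff (x, i) (flipAt x i, j) = if x i = 0 then 1 else -1 := if_pos rfl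

lemma payoff_self (x : Config N) (i j : Fin N) :
    payoff (x, i) (x, j) = if x i = 0 then -1 else 1 := by
  rw [payoff, if_neg (flipAt_ne x i).symm, if_pos rfl]

variable [NeZero N]

lemma changeProb_mul_payoff_add_stayProb_mul_payoff (p : Fin 4 → ℝ) (x : Config N) (i j k : Fin N) :
    changeProb p x i * payoff (x, i) (flipAt x i, j) + stayProb p x i * payoff (x, i) (x, k) =
      expectedPayoff p x i := by
  simp only [payoff_flipAt, payoff_self, changeProb, stayProb, expectedPayoff]
  split_ifs <;> ring

lemma transPstar_eq (p : Fin 4 → ℝ) (a b : State N) :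
    transPstar p a b = (N : ℝ)⁻¹ * ((if b.1 = flipAt a.1 a.2 then changeProb p a.1 a.2 else 0) +
      if b.1 = a.1 then stayProb p a.1 a.2 else 0) := by
  unfold transPstar
  split_ifs with hflip hstay
  · exact absurd (hflip.symm.trans hstay) (flipAt_ne a.1 a.2)
  all_goals simp

lemma sum_transPstar_mul (p : Fin 4 → ℝ) (f : State N → ℝ) (x : Config N) (i : Fin N) :
    ∑ b, transPstar p (x, i) b * f b =
      changeProb p x i * ((N : ℝ)⁻¹ * ∑ j, f (flipAt x i, j)) +
        stayProb p x i * ((N : ℝ)⁻¹ * ∑ j, f (x, j)) := by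
  simp only [transPstar_eq, mul_assoc, ← Finset.mul_sum, Fintype.sum_prod_type_right, add_mul,
    ite_mul, zero_mul, Finset.sum_add_distrib, Finset.sum_ite_eq', Finset.mem_univ, if_true]
  ring

/-- Mean payoff of a turn in configuration `x`, the player being chosen uniformly. -/
noncomputable def averagePayoff (p : Fin 4 → ℝ) (x : Config N) : ℝ :=
  (N : ℝ)⁻¹ * ∑ i, expectedPayoff p x i

lemma meanProfit_eq_dotProduct (p : Fin 4 → ℝ) (ρ : Config N → ℝ) :
    meanProfit p ρ = ρ ⬝ᵥ averagePayoff p := by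
  simp only [dotProduct, averagePayoff, mul_left_comm _ (N : ℝ)⁻¹, ← Finset.mul_sum]
  rfl

/-- Solution of the Poisson equation of the chain on `State N` obtained from a solution `g` of the
Poisson equation of the chain on `Config N`: when `i` is the next player in configuration `x`, the
mean excess payoff of this turn over `μ` plus the mean value of `g` after it. -/
noncomputable def liftPotential (p : Fin 4 → ℝ) (μ : ℝ) (g : Config N → ℝ) (a : State N) : ℝ :=
  expectedPayoff p a.1 a.2 - μ +
    (changeProb p a.1 a.2 * g (flipAt a.1 a.2) + stayProb p a.1 a.2 * g a.1)

lemma average_liftPotential {μ : ℝ} {g : Config N → ℝ}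
    (hg : g - transP p *ᵥ g = averagePayoff p - μ • 1) (x : Config N) :
    (N : ℝ)⁻¹ * ∑ j, liftPotential p μ g (x, j) = g x := by
  have hx := congrFun hg x
  simp only [Pi.sub_apply, Pi.smul_apply, Pi.one_apply, smul_eq_mul, mul_one, transP_mulVec,
    averagePayoff] at hx
  simp only [liftPotential, Finset.sum_add_distrib (f := fun _ => _ - _),
    Finset.sum_sub_distrib, mul_add _ (_ - _), mul_sub, natCast_inv_mul_sum_const]
  linarith

lemma sum_transPstar_mul_payoff_eq_zero {μ : ℝ} {g : Config N → ℝ}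
    (hg : g - transP p *ᵥ g = averagePayoff p - μ • 1) (a : State N) :
    ∑ b, transPstar p a b *
      (payoff a b - μ + liftPotential p μ g b - liftPotential p μ g a) = 0 := by
  obtain ⟨x, i⟩ := a
  have haverage (y : Config N) (c c' : ℝ) :
      (N : ℝ)⁻¹ * ∑ j, (c + liftPotential p μ g (y, j) - c') = c + g y - c' := by
    rw [Finset.sum_sub_distrib, Finset.sum_add_distrib, mul_sub, mul_add, natCast_inv_mul_sum_const,
      natCast_inv_mul_sum_const, average_liftPotential hg]
  rw [sum_transPstar_mul]
  simp only [payoff_flipAt, payoff_self, haverage]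
  have hmean := changeProb_mul_payoff_add_stayProb_mul_payoff p x i i i
  rw [payoff_flipAt, payoff_self] at hmean
  simp only [liftPotential]
  linear_combination hmean - (expectedPayoff p x i +
    (changeProb p x i * g (flipAt x i) + stayProb p x i * g x)) * changeProb_add_stayProb p x i

theorem IsMarkovChain.ae_tendsto_cumProfit {Ω : Type*} [MeasurableSpace Ω] {Pr : Measure Ω}
    [IsFiniteMeasure Pr] {X : ℕ → Ω → State N} (hX : IsMarkovChain (transPstar p) X Pr)
    {μ : ℝ} {g : Config N → ℝ} (hg : g - transP p *ᵥ g = averagePayoff p - μ • 1) :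
    ∀ᵐ ω ∂Pr, Tendsto (fun n : ℕ => (n : ℝ)⁻¹ * cumProfit X n ω) atTop (𝓝 μ) :=
  hX.ae_tendsto_average (sum_transPstar_mul_payoff_eq_zero hg)

end Profit

end Parrondo

open Parrondo in
theorem mainTheorem10_general {Ω : Type*} [MeasurableSpace Ω] {Pr : Measure Ω} [IsFiniteMeasure Pr]
    {N : ℕ} [NeZero N] (hN : 3 ≤ N) {p : Fin 4 → ℝ} (hp : ∀ m, p m ∈ Set.Icc (0 : ℝ) 1)
    (herg : ErgodicityConditions N p) {X : ℕ → Ω → State N} (hX : IsMarkovChain (transPstar p) X Pr)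
    {T : ℝ≥0 → Ω → ℕ} {r : ℝ} (hr : 0 < r)
    (hT : ∀ᵐ ω ∂Pr, Tendsto (fun t : ℝ≥0 => (T t ω : ℝ) / t) atTop (𝓝 r)) :
    ∃ ρ : Config N → ℝ,
      IsStationary (transP p) ρ ∧
      (∀ ρ' : Config N → ℝ, IsStationary (transP p) ρ' → ρ' = ρ) ∧
      (∀ᵐ ω ∂Pr, Tendsto (fun t : ℝ≥0 => (t : ℝ)⁻¹ * cumProfitCts X T t ω) atTop
        (𝓝 (r * meanProfit p ρ))) ∧
      (∀ᵐ ω ∂Pr, Tendsto (fun n : ℕ => (n : ℝ)⁻¹ * cumProfit X n ω) atTop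
        (𝓝 (meanProfit p ρ))) ∧
      (∀ (i j : Fin N) (u v : Fin 2),
        marginalPair ρ i (i + 2) u v = marginalPair ρ j (j + 2) u v) ∧
      (∀ i : Fin N, meanProfit p ρ =
        ∑ u : Fin 2, ∑ v : Fin 2, marginalPair ρ i (i + 2) u v *
          (p (pairIndex u v) - (1 - p (pairIndex u v)))) ∧
      (∀ i : Fin N, meanProfit p ρ = marginal ρ i 1 - marginal ρ i 0) := by
  obtain ⟨z, hz⟩ := herg.exists_forall_transP_reach hN hp
  have hP := transP_mem_rowStochastic (N := N) hp
  obtain ⟨ρ, hρ⟩ := exists_isStationary hP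
  obtain ⟨g, hg⟩ := hρ.exists_poisson hP hz (averagePayoff p)
  rw [← meanProfit_eq_dotProduct] at hg
  have huniq (ρ' : Config N → ℝ) (hρ' : IsStationary (transP p) ρ') : ρ' = ρ :=
    hρ.unique hρ' hP hz
  have hrotate (c : Fin N) : ρ ∘ rotate c = ρ :=
    huniq _ (hρ.comp_equiv (rotate c) (transP_submatrix_rotate p c))
  have hcum := hX.ae_tendsto_cumProfit hg
  refine ⟨ρ, hρ, huniq, ?_, hcum, fun i j => marginalPair_add_eq hrotate i j 2, fun i => ?_,
    fun i => ?_⟩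
  · filter_upwards [hcum, hT] with ω hω hTω
    exact tendsto_inv_mul_comp_of_tendsto_div hr hω hTω
  · rw [meanProfit_eq_playerProfit hrotate p (i + 1), playerProfit_add_one]
  · rw [meanProfit_eq_playerProfit hrotate p i, hρ.playerProfit_eq]

theorem mainTheorem10 {Ω : Type*} [MeasurableSpace Ω] (Pr : Measure Ω) [IsProbabilityMeasure Pr]
    (N : ℕ) [NeZero N] (hN : 3 ≤ N) (p : Fin 4 → ℝ) (hp : ∀ m, p m ∈ Set.Icc (0 : ℝ) 1)
    (herg : Parrondo.ErgodicityConditions N p)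
    (X : ℕ → Ω → Parrondo.State N) (T : ℝ≥0 → Ω → ℕ)
    (hXT : Parrondo.IsContinuousTimeModel p X T Pr) :
    ∃ ρ : Parrondo.Config N → ℝ,
      Parrondo.IsStationary (Parrondo.transP p) ρ ∧
      (∀ ρ' : Parrondo.Config N → ℝ, Parrondo.IsStationary (Parrondo.transP p) ρ' → ρ' = ρ) ∧
      (∀ᵐ ω ∂Pr, Tendsto (fun t : ℝ≥0 => (t : ℝ)⁻¹ * Parrondo.cumProfitCts X T t ω) atTop
        (𝓝 (Parrondo.meanProfit p ρ))) ∧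
      (∀ᵐ ω ∂Pr, Tendsto (fun n : ℕ => (n : ℝ)⁻¹ * Parrondo.cumProfit X n ω) atTop
        (𝓝 (Parrondo.meanProfit p ρ))) ∧
      (∀ (i j : Fin N) (u v : Fin 2),
        Parrondo.marginalPair ρ i (i + 2) u v = Parrondo.marginalPair ρ j (j + 2) u v) ∧
      (∀ i : Fin N, Parrondo.meanProfit p ρ =
        ∑ u : Fin 2, ∑ v : Fin 2, Parrondo.marginalPair ρ i (i + 2) u v *
          (p (Parrondo.pairIndex u v) - (1 - p (Parrondo.pairIndex u v)))) ∧
      (∀ i : Fin N,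
        Parrondo.meanProfit p ρ = Parrondo.marginal ρ i 1 - Parrondo.marginal ρ i 0) := by
  simpa using mainTheorem10_general hN hp herg hXT.chain one_pos hXT.poisson.ae_tendsto_div
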